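/- Let $F$ be a (commutative) field, let $n$ be a positive integer, let $A\in F^{n\times n}$ and let $\lambda\in F$. Write $$C_F(A,\lambda):=\{B\in F^{n\times n}\mid AB-\lambda BA=0\},$$ an $F$-subspace of $F^{n\times n}$, and let $m_A(t)\in F[t]$ be the minimal polynomial of $A$. Suppose that $A$ is not a scalar matrix (that is, $A\neq cI$ for every $c\in F$) and that $\lambda\neq 0$. Then $$\dim_F C_F(A,\lambda)\le (n-1)^2+1 .$$ If $n\ge 2$ and equality holds, then $m_A(t)$ is quadratic (has degree $2$). If $n\ge 3$ and equality holds, then moreover $m_A(t)$ is reducible over $F$. -/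

import Mathlib

/-- The twisted centralizer code `C_F(A, l) = {B | A B - l B A = 0}`, as an `F`-subspace of the
space of `n × n` matrices over `F`. -/
def twistedCentralizer {F : Type*} [Field F] {n : ℕ} (A : Matrix (Fin n) (Fin n) F) (l : F) :
    Submodule F (Matrix (Fin n) (Fin n) F) where
  carrier := {B | A * B - l • (B * A) = 0}
  zero_mem' := by simp
  add_mem' := by
    intro B C hB hC
    simp only [Set.mem_setOf_eq, sub_eq_zero] at hB hC ⊢
    rw [mul_add, add_mul, smul_add, hB, hC]
  smul_mem' := by
    intro c B hB
    simp only [Set.mem_setOf_eq, sub_eq_zero] at hB ⊢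
    rw [Matrix.mul_smul, Matrix.smul_mul, hB, smul_comm]

open Module Submodule

/-! If `A B = l B A` with `l ≠ 0`, then `ker B` is `A`-invariant, so `B` is determined by its values
on vectors generating `Fⁿ` under `A`; `k` generators give dimension at most `k n`. For `n ≥ 3`, a
cyclic subspace of dimension at least 3, or two independent cyclic planes, leave only `n - 2`
generators, and `(n - 2) n = (n - 1)² - 1` is strictly too small for equality. Otherwise `A = c + N`
with `N` of rank one (`exists_scalar_add_rank_one`). Then `v` and `n - 2` vectors of `ker N`
generate; `B` maps the latter into the `l c`-eigenspace, which is proper, giving `n + (n - 2)(n - 1)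
= (n - 1)² + 1`. Here `N² = q N`, so `A` is killed by `(t - c - q)(t - c)`. -/

/-! ### Evaluation at generating vectors -/

/-- A family of vectors that generates `Fⁿ` under `A` bounds the dimension of the twisted
centralizer by the dimensions of the spaces in which the images of these vectors lie. -/
theorem finrank_twistedCentralizer_le_sum {F : Type*} [Field F] {n : ℕ}
    {A : Matrix (Fin n) (Fin n) F} {l : F} (hl : l ≠ 0) {ι : Type*} [Fintype ι]
    (v : ι → Fin n → F) (E : ι → Submodule F (Fin n → F))
    (hE : ∀ B ∈ twistedCentralizer A l, ∀ i, B.mulVec (v i) ∈ E i)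
    (hv : ∀ W : Submodule F (Fin n → F), (∀ i, v i ∈ W) → (∀ w ∈ W, A.mulVec w ∈ W) → W = ⊤) :
    finrank F (twistedCentralizer A l) ≤ ∑ i, finrank F (E i) := by
  let ev : twistedCentralizer A l →ₗ[F] ((i : ι) → E i) :=
    LinearMap.pi fun i => LinearMap.codRestrict (E i)
      { toFun := fun B => B.1.mulVec (v i)
        map_add' := fun B C => Matrix.add_mulVec _ _ _
        map_smul' := fun c B => Matrix.smul_mulVec _ _ _ } (fun B => hE B.1 B.2 i)
  have hinj : Function.Injective ev := by
    rw [← LinearMap.ker_eq_bot, LinearMap.ker_eq_bot']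
    rintro ⟨B, hB⟩ h0
    have h0' : ∀ i, B.mulVec (v i) = 0 := fun i => congrArg Subtype.val (congrFun h0 i)
    have hcomm : A * B = l • (B * A) := sub_eq_zero.mp hB
    have htop := hv (LinearMap.ker B.mulVecLin) h0' (by
      intro w hw
      have hw' : B.mulVec w = 0 := hw
      have h1 : l • B.mulVec (A.mulVec w) = 0 := by
        rw [Matrix.mulVec_mulVec, ← Matrix.smul_mulVec, ← hcomm, ← Matrix.mulVec_mulVec, hw',
          Matrix.mulVec_zero]
      exact (smul_eq_zero.mp h1).resolve_left hl)
    have hB0 : B = 0 := by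
      apply Matrix.toLin'.injective
      rw [map_zero]
      exact LinearMap.ker_eq_top.mp htop
    exact Subtype.ext hB0
  calc finrank F (twistedCentralizer A l) ≤ finrank F ((i : ι) → E i) :=
        LinearMap.finrank_le_finrank_of_injective hinj
    _ = _ := finrank_pi_fintype F

/-- If `W ⊔ U = ⊤`, then `W` can be complemented by the span of `dim V - dim W` vectors of `U`. -/
theorem exists_family_sup_span_eq_top {F V : Type*} [Field F] [AddCommGroup V] [Module F V]
    [FiniteDimensional F V] (W U : Submodule F V) (h : W ⊔ U = ⊤) :
    ∃ y : Fin (finrank F V - finrank F W) → V, (∀ i, y i ∈ U) ∧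
      W ⊔ span F (Set.range y) = ⊤ := by
  have hd : finrank F (V ⧸ W) = finrank F V - finrank F W := by
    have := W.finrank_quotient_add_finrank
    omega
  let b := finBasisOfFinrankEq F (V ⧸ W) hd
  have hex : ∀ i, ∃ y ∈ U, W.mkQ y = b i := by
    intro i
    obtain ⟨x, hx⟩ := W.mkQ_surjective (b i)
    obtain ⟨w, hw, u, hu, hwu⟩ := mem_sup.mp (h ▸ mem_top : x ∈ W ⊔ U)
    refine ⟨u, hu, ?_⟩
    rw [← hx, ← hwu, map_add, (by simpa using hw : W.mkQ w = 0), zero_add]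
  choose y hyU hyb using hex
  refine ⟨y, hyU, ?_⟩
  rw [← map_mkQ_eq_top, map_span, ← Set.range_comp]
  have : ⇑W.mkQ ∘ y = b := funext hyb
  rw [this, b.span_eq]

/-- If `k` vectors generate under `A` a space of dimension at least `d`, then the twisted
centralizer has dimension at most `(k + (n - d)) * n`. -/
theorem finrank_twistedCentralizer_le_mul {F : Type*} [Field F] {n : ℕ}
    {A : Matrix (Fin n) (Fin n) F} {l : F} (hl : l ≠ 0) {ι κ : Type*} [Fintype ι] [Fintype κ]
    (v : ι → Fin n → F) (x : κ → Fin n → F) (hx : LinearIndependent F x)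
    (hv : ∀ W : Submodule F (Fin n → F), (∀ i, v i ∈ W) → (∀ w ∈ W, A.mulVec w ∈ W) →
      ∀ k, x k ∈ W) :
    finrank F (twistedCentralizer A l) ≤ (Fintype.card ι + (n - Fintype.card κ)) * n := by
  obtain ⟨y, -, hy⟩ := exists_family_sup_span_eq_top (span F (Set.range x)) ⊤ (by simp)
  have := finrank_twistedCentralizer_le_sum (A := A) hl (Sum.elim v y) (fun _ => ⊤)
    (fun _ _ _ => mem_top) (by
      intro W hW hA
      rw [eq_top_iff, ← hy, sup_le_iff, span_le, span_le, Set.range_subset_iff,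
        Set.range_subset_iff]
      exact ⟨hv W (fun i => hW (Sum.inl i)) hA, fun i => hW (Sum.inr i)⟩)
  simpa [finrank_span_eq_card hx] using this

/-! ### Operators with few cyclic directions -/

/-- An endomorphism without a cyclic subspace of dimension `3` and without two independent cyclic
planes is, beyond dimension `2`, a scalar plus an endomorphism of rank one. -/
theorem exists_scalar_add_rank_one {F V : Type*} [Field F] [AddCommGroup V] [Module F V]
    (f : V →ₗ[F] V) (v : V) (hv : LinearIndependent F ![v, f v])
    (h3 : ∀ x, ¬ LinearIndependent F ![x, f x, f (f x)])
    (h4 : ∀ y, ¬ LinearIndependent F (Sum.elim ![v, f v] ![y, f y]))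
    (hW : span F {v, f v} ≠ ⊤) :
    ∃ c q : F, f (f v - c • v) - c • (f v - c • v) = q • (f v - c • v) ∧
      ∀ x, ∃ t : F, f x - c • x = t • (f v - c • v) := by
  have hvp := LinearIndependent.pair_iff.mp hv
  set W := span F {v, f v} with hWdef
  have hvW : v ∈ W := subset_span (by simp)
  have hfvW : f v ∈ W := subset_span (by simp)
  have h3' : ∀ x, ¬ ∀ a b d : F, a • x + b • f x + d • f (f x) = 0 → a = 0 ∧ b = 0 ∧ d = 0 := by
    intro x hx
    apply h3 x
    rw [Fintype.linearIndependent_iff]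
    intro g hg
    obtain ⟨h0, h1, h2⟩ := hx (g 0) (g 1) (g 2) (by simpa [Fin.sum_univ_three] using hg)
    intro i
    fin_cases i <;> assumption
  have hffv : f (f v) ∈ W := by
    by_contra hn
    refine h3' v fun a b d h => ?_
    have hd : d = 0 := by
      by_contra hd
      apply hn
      rw [← W.smul_mem_iff hd, (by linear_combination (norm := module) h :
        d • f (f v) = -(a • v) + -(b • f v))]
      exact W.add_mem (W.neg_mem (W.smul_mem _ hvW)) (W.neg_mem (W.smul_mem _ hfvW))
    subst hd
    obtain ⟨ha, hb⟩ := hvp a b (by simpa using h)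
    exact ⟨ha, hb, rfl⟩
  have hinv : W ≤ W.comap f := by
    rw [hWdef, span_le]
    rintro x (rfl | rfl)
    · exact hfvW
    · exact hffv
  -- Every vector of `V ⧸ W` is an eigenvector of the induced map: an independent pair there would
  -- lift to a second cyclic plane. Hence that map is a scalar.
  obtain ⟨c, hc⟩ := (W.mapQ W f hinv).exists_eq_smul_id_of_forall_notLinearIndependent (by
    intro y
    obtain ⟨y, rfl⟩ := W.mkQ_surjective y
    intro hy
    apply h4 y
    have hli : LinearIndependent F (![⟨v, hvW⟩, ⟨f v, hfvW⟩] : Fin 2 → W) := by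
      apply LinearIndependent.of_comp W.subtype
      convert! hv using 1
      ext i; fin_cases i <;> rfl
    have := hli.sumElim_of_quotient ![y, f y] (by
      convert! hy using 1
      ext i; fin_cases i <;> rfl)
    convert! this using 1
    ext i; rcases i with i | i <;> fin_cases i <;> rfl)
  let N : V →ₗ[F] V := f - c • LinearMap.id
  have hN : ∀ x, N x = f x - c • x := fun x => rfl
  have hNW : ∀ x, N x ∈ W := by
    intro x
    have := LinearMap.congr_fun hc (W.mkQ x)
    rw [← W.ker_mkQ, LinearMap.mem_ker, hN, map_sub, map_smul, sub_eq_zero]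
    simpa using this
  have h3N : ∀ x, ¬ ∀ a b d : F, a • x + b • N x + d • N (N x) = 0 →
      a = 0 ∧ b = 0 ∧ d = 0 := by
    intro x hx
    refine h3' x fun a b d h => ?_
    -- Coefficients of `a + b f + d f²` rewritten in powers of `N = f - c`.
    obtain ⟨h0, h1, h2⟩ := hx (a + b * c + d * c ^ 2) (b + 2 * d * c) d (by
      rw [← h]
      simp only [hN, map_sub, map_smul]
      module)
    subst h2
    have hb : b = 0 := by simpa using h1
    subst hb
    exact ⟨by simpa using h0, rfl, rfl⟩
  set w := N v with hw
  have hvw : ∀ a b : F, a • v + b • w = 0 → a = 0 ∧ b = 0 := by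
    intro a b h
    obtain ⟨h0, h1⟩ := hvp (a - b * c) b (by rw [← h, hw, hN]; module)
    subst h1
    exact ⟨by simpa using h0, rfl⟩
  have hwW : w ∈ W := hNW v
  have hmem : ∀ x ∈ W, ∃ a b : F, x = a • v + b • w := by
    intro x hx
    obtain ⟨a, b, rfl⟩ := mem_span_pair.mp hx
    exact ⟨a + b * c, b, by rw [hw, hN]; module⟩
  have hind : ∀ y ∉ W, ∀ a b d : F, a • y + b • v + d • w = 0 → a = 0 ∧ b = 0 ∧ d = 0 := by
    intro y hy a b d h
    have ha : a = 0 := by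
      by_contra ha
      apply hy
      rw [← W.smul_mem_iff ha, (by linear_combination (norm := module) h :
        a • y = -(b • v) + -(d • w))]
      exact W.add_mem (W.neg_mem (W.smul_mem _ hvW)) (W.neg_mem (W.smul_mem _ hwW))
    subst ha
    exact ⟨rfl, hvw b d (by simpa using h)⟩
  obtain ⟨p, q, hpq⟩ := hmem (N w) (hNW w)
  -- Subtracting `t • v` removes the `w`-component of `N y`, leaving `s • v`. If `s ≠ 0`, applying
  -- `N` again gives `s • w`, hence a three-dimensional cyclic subspace.
  have hout : ∀ y ∉ W, ∃ t : F, y - t • v ∉ W ∧ N (y - t • v) = 0 := by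
    intro y hy
    obtain ⟨s, t, hst⟩ := hmem (N y) (hNW y)
    have hy' : y - t • v ∉ W := fun h => hy ((W.sub_mem_iff_left (W.smul_mem t hvW)).mp h)
    have hs' : N (y - t • v) = s • v := by
      rw [map_sub, map_smul, hst]; module
    have hs : s = 0 := by
      by_contra hs
      refine h3N (y - t • v) fun a b d h => ?_
      rw [hs', map_smul, smul_smul, smul_smul] at h
      obtain ⟨ha, hb, hd⟩ := hind _ hy' _ _ _ h
      simp only [mul_eq_zero, hs, or_false] at hb hd
      exact ⟨ha, hb, hd⟩
    exact ⟨t, hy', by rw [hs', hs, zero_smul]⟩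
  -- With `y'` in `ker N` outside `W`, the iterates of `v + y'` are `w` and `p v + q w`, independent
  -- of it if `p ≠ 0`.
  have hp : p = 0 := by
    obtain ⟨y, -, hy⟩ := SetLike.exists_of_lt (lt_top_iff_ne_top.mpr hW)
    obtain ⟨t, hy', h0⟩ := hout y hy
    by_contra hp
    refine h3N (v + (y - t • v)) fun a b d h => ?_
    rw [map_add N, h0, add_zero, ← hw, hpq] at h
    obtain ⟨ha, hb, hd⟩ := hind _ hy' a (a + d * p) (b + d * q) (by rw [← h]; module)
    subst ha
    have hd' : d = 0 := by simpa [hp] using hb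
    subst hd'
    exact ⟨rfl, by simpa using hd, rfl⟩
  rw [hp, zero_smul, zero_add] at hpq
  refine ⟨c, q, hpq, fun x => ?_⟩
  by_cases hx : x ∈ W
  · obtain ⟨a, b, rfl⟩ := hmem x hx
    refine ⟨a + b * q, ?_⟩
    rw [← hN, map_add, map_smul, map_smul, hpq, ← hw, ← hN v, ← hw]
    module
  · obtain ⟨t, -, ht⟩ := hout x hx
    refine ⟨t, ?_⟩
    rw [map_sub, map_smul, sub_eq_zero] at ht
    exact ht

/-- The bound on the twisted centralizer for a scalar plus a matrix of rank one. -/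
theorem finrank_twistedCentralizer_le_of_rank_one {F : Type*} [Field F] {n : ℕ}
    {A : Matrix (Fin n) (Fin n) F} {l : F} (hl : l ≠ 0)
    (hA : ∀ c : F, A ≠ c • (1 : Matrix (Fin n) (Fin n) F)) (v : Fin n → F)
    (hv : LinearIndependent F ![v, A.mulVec v]) (c : F)
    (h : ∀ x, ∃ t : F, A.mulVec x - c • x = t • (A.mulVec v - c • v)) :
    finrank F (twistedCentralizer A l) ≤ n + (n - 2) * (n - 1) := by
  set W := span F (Set.range ![v, A.mulVec v]) with hW
  have hdim : finrank F W = 2 := by simpa using finrank_span_eq_card hv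
  let U := LinearMap.ker (A.mulVecLin - c • LinearMap.id)
  have hU : ∀ x, x ∈ U ↔ A.mulVec x = c • x := fun x => sub_eq_zero
  have hvW : v ∈ W := subset_span ⟨0, rfl⟩
  -- `N v` spans the image of `N`, so each `x` differs from a multiple of `v` by an element of `ker
  -- N`.
  obtain ⟨y, hyU, hy⟩ := exists_family_sup_span_eq_top W U (by
    rw [eq_top_iff]
    intro x _
    obtain ⟨t, ht⟩ := h x
    refine mem_sup.mpr ⟨t • v, W.smul_mem t hvW, x - t • v, ?_, by abel⟩
    rw [hU, Matrix.mulVec_sub, Matrix.mulVec_smul]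
    linear_combination (norm := module) ht)
  let E := LinearMap.ker (A.mulVecLin - (l * c) • LinearMap.id)
  have hE : finrank F E ≤ n - 1 := by
    have hne : E ≠ ⊤ := by
      intro htop
      have h0 := LinearMap.ker_eq_top.mp htop
      apply hA (l * c)
      apply Matrix.toLin'.injective
      rw [map_smul, Matrix.toLin'_one]
      exact sub_eq_zero.mp h0
    have := finrank_lt hne
    rw [finrank_fin_fun] at this
    omega
  have key := finrank_twistedCentralizer_le_sum (A := A) hl
    (Sum.elim (fun _ : Unit => v) y) (Sum.elim (fun _ => ⊤) (fun _ => E)) (by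
      rintro B hB (i | i)
      · exact mem_top
      · have hcomm : A * B = l • (B * A) := sub_eq_zero.mp hB
        change A.mulVec (B.mulVec (y i)) - (l * c) • B.mulVec (y i) = 0
        rw [Matrix.mulVec_mulVec, hcomm, Matrix.smul_mulVec, ← Matrix.mulVec_mulVec,
          (hU _).mp (hyU i), Matrix.mulVec_smul, smul_smul, sub_self]) (by
      intro X hX hAX
      have hvX : v ∈ X := hX (Sum.inl ())
      rw [eq_top_iff, ← hy, sup_le_iff, span_le, span_le, Set.range_subset_iff,
        Set.range_subset_iff]
      refine ⟨fun i => ?_, fun i => hX (Sum.inr i)⟩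
      fin_cases i
      · exact hvX
      · exact hAX v hvX)
  refine key.trans ((Finset.sum_le_sum (g := Sum.elim (fun _ => n) (fun _ => n - 1)) ?_).trans ?_)
  · rintro (i | i) -
    · exact (finrank_le _).trans_eq (finrank_fin_fun F)
    · exact hE
  · simp [hdim]

/-! ### The minimal polynomial and the case analysis -/

/-- A non-scalar matrix annihilated by a product of two linear factors has a reducible minimal
polynomial of degree two. -/
theorem natDegree_minpoly_eq_two_and_not_irreducible {F R : Type*} [Field F] [Ring R]
    [Algebra F R] [Nontrivial R] (A : R) (hA : A ∉ (algebraMap F R).range) (c d : F)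
    (h : (A - algebraMap F R c) * (A - algebraMap F R d) = 0) :
    (minpoly F A).natDegree = 2 ∧ ¬ Irreducible (minpoly F A) := by
  have hm : ((Polynomial.X - Polynomial.C c) * (Polynomial.X - Polynomial.C d)).Monic :=
    (Polynomial.monic_X_sub_C c).mul (Polynomial.monic_X_sub_C d)
  have ha : Polynomial.aeval A
      ((Polynomial.X - Polynomial.C c) * (Polynomial.X - Polynomial.C d)) = 0 := by
    simpa using h
  have hint : IsIntegral F A := ⟨_, hm, ha⟩
  have h2 := (minpoly.two_le_natDegree_iff hint).mpr hA
  have hdvd := minpoly.dvd F A ha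
  have hle : (minpoly F A).natDegree ≤ 2 := by
    refine (Polynomial.natDegree_le_of_dvd hdvd hm.ne_zero).trans ?_
    rw [(Polynomial.monic_X_sub_C c).natDegree_mul (Polynomial.monic_X_sub_C d)]
    simp
  refine ⟨le_antisymm hle h2, fun hirr => ?_⟩
  rcases hirr.prime.dvd_or_dvd hdvd with hc | hc
  · have := Polynomial.natDegree_le_of_dvd hc (Polynomial.X_sub_C_ne_zero c)
    rw [Polynomial.natDegree_X_sub_C] at this
    omega
  · have := Polynomial.natDegree_le_of_dvd hc (Polynomial.X_sub_C_ne_zero d)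
    rw [Polynomial.natDegree_X_sub_C] at this
    omega

theorem proposition5p5 {F : Type*} [Field F] (n : ℕ) (A : Matrix (Fin n) (Fin n) F) (l : F)
    (hA : ∀ c : F, A ≠ c • (1 : Matrix (Fin n) (Fin n) F)) (hl : l ≠ 0) :
    (Module.finrank F (twistedCentralizer A l) : ℤ) ≤ ((n : ℤ) - 1) ^ 2 + 1 ∧
    ((Module.finrank F (twistedCentralizer A l) : ℤ) = ((n : ℤ) - 1) ^ 2 + 1 →
      (2 ≤ n → (minpoly F A).natDegree = 2) ∧
      (3 ≤ n → ¬ Irreducible (minpoly F A))) := by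
  have hrange : A ∉ (algebraMap F (Matrix (Fin n) (Fin n) F)).range := by
    rintro ⟨c, hc⟩
    exact hA c (by rw [← hc, Algebra.algebraMap_eq_smul_one])
  obtain ⟨v, hv⟩ : ∃ v, LinearIndependent F ![v, A.mulVec v] := by
    by_contra! hn
    obtain ⟨c, hc⟩ := A.mulVecLin.exists_eq_smul_id_of_forall_notLinearIndependent hn
    apply hA c
    apply Matrix.toLin'.injective
    rw [map_smul, Matrix.toLin'_one]
    exact hc
  have hn2 : 2 ≤ n := by simpa using hv.fintype_card_le_finrank
  have : Nonempty (Fin n) := ⟨⟨0, by omega⟩⟩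
  obtain rfl | hn3 : n = 2 ∨ 3 ≤ n := by omega
  · refine ⟨?_, fun _ => ⟨fun _ => ?_, fun h => by omega⟩⟩
    · have := finrank_twistedCentralizer_le_mul (A := A) hl (fun _ : Unit => v) _ hv (by
        intro W hW hAW i
        fin_cases i
        · exact hW ()
        · exact hAW _ (hW ()))
      simp only [Fintype.card_unit, Fintype.card_fin] at this
      push_cast
      omega
    · apply le_antisymm
      · have := Polynomial.natDegree_le_of_dvd (Matrix.minpoly_dvd_charpoly A)
          A.charpoly_monic.ne_zero
        rwa [A.charpoly_natDegree_eq_dim, Fintype.card_fin] at this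
      · exact (minpoly.two_le_natDegree_iff (Matrix.isIntegral A)).mpr hrange
  have finish (h : finrank F (twistedCentralizer A l) ≤ (n - 2) * n) :
      (finrank F (twistedCentralizer A l) : ℤ) < ((n : ℤ) - 1) ^ 2 + 1 := by
    zify [hn2] at h
    nlinarith
  by_cases h3 : ∃ x, LinearIndependent F ![x, A.mulVec x, A.mulVec (A.mulVec x)]
  · obtain ⟨x, hx⟩ := h3
    have hlt := finish (by
      have := finrank_twistedCentralizer_le_mul (A := A) hl (fun _ : Unit => x) _ hx (by
        intro W hW hAW i
        fin_cases i
        · exact hW ()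
        · exact hAW _ (hW ())
        · exact hAW _ (hAW _ (hW ())))
      rwa [Fintype.card_unit, Fintype.card_fin, (by omega : 1 + (n - 3) = n - 2)] at this)
    exact ⟨hlt.le, fun h => absurd h hlt.ne⟩
  by_cases h4 : ∃ y, LinearIndependent F (Sum.elim ![v, A.mulVec v] ![y, A.mulVec y])
  · obtain ⟨y, hy⟩ := h4
    have hn4 : 4 ≤ n := by simpa using hy.fintype_card_le_finrank
    have hlt := finish (by
      have := finrank_twistedCentralizer_le_mul (A := A) hl ![v, y] _ hy (by
        intro W hW hAW i
        rcases i with i | i <;> fin_cases i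
        · exact hW 0
        · exact hAW _ (hW 0)
        · exact hW 1
        · exact hAW _ (hW 1))
      rwa [Fintype.card_sum, Fintype.card_fin, (by omega : 2 + (n - (2 + 2)) = n - 2)] at this)
    exact ⟨hlt.le, fun h => absurd h hlt.ne⟩
  push Not at h3 h4
  obtain ⟨c, q, hq, hc⟩ := exists_scalar_add_rank_one A.mulVecLin v hv h3 h4 (by
    intro htop
    have h2 := finrank_span_eq_card hv
    rw [Matrix.range_cons_cons_empty] at h2
    rw [Matrix.mulVecLin_apply] at htop
    rw [htop, finrank_top, finrank_fin_fun, Fintype.card_fin] at h2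
    omega)
  have hle := finrank_twistedCentralizer_le_of_rank_one hl hA v hv c hc
  -- `N` maps everything to multiples of `w = N v`, and `N w = q w`, so `(N - q) N = 0`.
  have hpoly := natDegree_minpoly_eq_two_and_not_irreducible A hrange (c + q) c (by
    apply Matrix.toLin'.injective
    refine LinearMap.ext fun x => ?_
    have he : ∀ (d : F) (x : Fin n → F),
        (A - algebraMap F _ d).mulVec x = A.mulVec x - d • x := by
      intro d x
      rw [Matrix.sub_mulVec, Algebra.algebraMap_eq_smul_one, Matrix.smul_mulVec,
        Matrix.one_mulVec]
    obtain ⟨t, ht⟩ := hc x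
    simp only [Matrix.mulVecLin_apply] at hq ht
    rw [Matrix.toLin'_apply, ← Matrix.mulVec_mulVec, he, he, ht, map_zero, LinearMap.zero_apply,
      Matrix.mulVec_smul]
    linear_combination (norm := module) t • hq)
  refine ⟨?_, fun _ => ⟨fun _ => hpoly.1, fun _ => hpoly.2⟩⟩
  zify [hn2, (by omega : 1 ≤ n)] at hle
  nlinarith
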